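/- Let $G$ be a compact connected Lie group acting smoothly and transitively on a (Hausdorff) smooth manifold $X$, let $\mu_X$ be a finite $G$-invariant Borel measure on $X$, $|X| := \mu_X(X)$, and let $p_X\in L^1(X,\mu_X)$ be a probability density (the prior). Let $\mathcal H_B$ be a finite-dimensional unitary representation of $G$ (strongly continuous), and let $(\rho^x_B)_{x\in X}$ be a covariant family of density operators on $\mathcal H_B$, i.e. $\rho_B^{gx} = g\rho_B^x g^{-1}$ for all $g \in G$, $x\in X$. A region estimator consists of a POVM $M_B$ on $\mathcal H_B$ with outcomes in a measurable space $Y$ and a measurable set $\mathcal E\subseteq X\times Y$. Put $\mathcal E_x=\{y:(x,y)\in\mathcal E\}$, $\mathcal E_y=\{x:(x,y)\in\mathcal E\}$, $$p_{\rm succ}=\int_X p_X^x\,\mathrm{tr}\big(\rho^x_B M_B(\mathcal E_x)\big)\,d\mu_X(x),\qquad V_{\max}=\sup_{y\in Y}\mu_X(\mathcal E_y).$$ For densities $p,q\in L^1(X,\mu_X)$ and $\alpha\in[0,1]$ let $$\beta_\alpha(p,q)=\inf\Big\{\int_X q^xE^x\,d\mu_X(x)\;:\;E\colon X\to[0,1]\text{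 measurable},\ \int_X p^xE^x\,d\mu_X(x)\ge\alpha\Big\},$$ and let $\mathbb 1_X/|X|$ be the constant density $1/|X|$. Fix a base point $x_0\in X$ with stabilizer $K\subseteq G$. Let $\lambda$ run over the isomorphism classes of irreducible representations $V_{G,\lambda}$ of $G$ that occur in $\mathcal H_B$, with dimension $d_\lambda$ and multiplicity $m_\lambda$ in $\mathcal H_B$, and let $\mu$ run over the isomorphism classes of irreducible representations $V_{K,\mu}$ of $K$ that occur in the restriction of $\mathcal H_B$ to $K$, with dimension $d_\mu$. Let $m^\lambda_\mu$ be the multiplicity of $V_{K,\mu}$ in the restriction of $V_{G,\lambda}$ to $K$, and $r^\lambda_\mu=\min\{m^\lambda_\mu,m_\lambda\}$. Theorem. For every region estimator, every covariant family and every prior $p_X$ as above, and every base point $x_0$, $$\frac{V_{\max}}{|X|}\ \ge\ \beta_{p_{\rm succ}}\Big(p_X,\frac{\mathbb 1_X}{|X|}\Big)\,\frac{1}{\max_\mu\sum_\lambda d_\lambda r^\lambda_\mu/d_\mu}.$$ In particular, if $X=G$, acted on by left multiplication and equipped with a Haar measure, then $$\frac{V_{\max}}{|X|}\ \ge\ \beta_{p_{\rm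 succ}}\Big(p_X,\frac{\mathbb 1_X}{|X|}\Big)\,\frac{1}{\sum_\lambda d_\lambda r_\lambda},\qquad r_\lambda=\min\{d_\lambda,m_\lambda\}.$$ -/

import Mathlib

open MeasureTheory
open scoped ContDiff Manifold InnerProductSpace

noncomputable section

/-! ### Quantum states, measurements and region estimators -/

namespace CovariantEstimation

section Quantum

variable {X Y H : Type*} [NormedAddCommGroup H] [InnerProductSpace ℂ H]

/-- The pairing `⟨A, B⟩ = tr (A B)` between operators on a finite-dimensional Hilbert space. It is
real when `A` and `B` are Hermitian, which is the only case in which it is used. -/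
def pairing (A B : H →L[ℂ] H) : ℝ :=
  (LinearMap.trace ℂ H ((A ∘L B : H →L[ℂ] H) : H →ₗ[ℂ] H)).re

/-- Quantum states: density operators, i.e. positive semidefinite operators of trace one. -/
structure IsState (ρ : H →L[ℂ] H) : Prop where
  isPositive : ρ.IsPositive
  trace_eq_one : LinearMap.trace ℂ H (ρ : H →ₗ[ℂ] H) = 1

variable (Y H) in
/-- A positive operator-valued measure on `H` with outcomes in the measurable space `Y`: a
σ-additive function `M` on the measurable sets with `M O ≥ 0`, `M ∅ = 0` and `M Y = 1`. For
finite-dimensional `H` weak and norm σ-additivity coincide. -/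
structure POVM [MeasurableSpace Y] where
  toVectorMeasure : VectorMeasure Y (H →L[ℂ] H)
  isPositive : ∀ O : Set Y, MeasurableSet O → (toVectorMeasure O).IsPositive
  univ_eq_one : toVectorMeasure Set.univ = ContinuousLinearMap.id ℂ H

variable (X Y H) in
/-- A region estimator: a POVM with outcomes in `Y`, and a measurable look-up table in `X × Y`. -/
structure RegionEstimator [MeasurableSpace X] [MeasurableSpace Y] where
  povm : POVM Y H
  table : Set (X × Y)
  measurableSet_table : MeasurableSet table

namespace RegionEstimator

variable [MeasurableSpace X] [MeasurableSpace Y]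

/-- The region reported on the outcome `y`. -/
def region (R : RegionEstimator X Y H) (y : Y) : Set X := {x | (x, y) ∈ R.table}

/-- The set of outcomes that are compatible with the parameter value `x`. -/
def compatible (R : RegionEstimator X Y H) (x : X) : Set Y := {y | (x, y) ∈ R.table}

/-- The average success probability `∫ p(x) ⟨ρ x, M (compatible x)⟩ dμ(x)`. -/
def successProb (R : RegionEstimator X Y H) (μ : Measure X) (p : X → ℝ) (ρ : X → H →L[ℂ] H) : ℝ :=
  ∫ x, p x * pairing (ρ x) (R.povm.toVectorMeasure (R.compatible x)) ∂μ

/-- The maximal volume of the reported regions. -/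
def maxVolume (R : RegionEstimator X Y H) (μ : Measure X) : ENNReal :=
  ⨆ y : Y, μ (R.region y)

end RegionEstimator

/-- `p` is a probability density in `L¹(X, μ)`. -/
structure IsProbabilityDensity [MeasurableSpace X] (μ : Measure X) (p : X → ℝ) : Prop where
  integrable : Integrable p μ
  nonneg : 0 ≤ᵐ[μ] p
  integral_eq_one : ∫ x, p x ∂μ = 1

/-- The constant density `𝟙 / |X|`. -/
def uniformDensity [MeasurableSpace X] (μ : Measure X) : X → ℝ := fun _ => 1 / μ.real Set.univ

/-- The minimal type-II error `β_α(p, q)` of a test between the null hypothesis with density `p`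
and the alternative with density `q`, when the null hypothesis is to be identified correctly with
probability at least `α`. Tests are the measurable functions `0 ≤ E ≤ 1`. -/
def minTypeIIError [MeasurableSpace X] (μ : Measure X) (α : ℝ) (p q : X → ℝ) : ℝ :=
  sInf {b : ℝ | ∃ E : X → ℝ, Measurable E ∧ (∀ x, 0 ≤ E x ∧ E x ≤ 1) ∧
    α ≤ ∫ x, p x * E x ∂μ ∧ b = ∫ x, q x * E x ∂μ}

end Quantum

/-! ### Representation-theoretic data -/

section Reps

variable {Γ V : Type*} [Group Γ] [AddCommGroup V] [Module ℂ V]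

/-- The irreducible subrepresentations of `π`. -/
abbrev IrredSub (π : Representation ℂ Γ V) : Type _ :=
  {W : Subrepresentation π // W.toRepresentation.IsIrreducible}

/-- Isomorphism of irreducible subrepresentations. -/
instance irredSubSetoid (π : Representation ℂ Γ V) : Setoid (IrredSub π) where
  r W W' := Nonempty (W.1.toRepresentation.Equiv W'.1.toRepresentation)
  iseqv :=
    { refl := fun _ => ⟨Representation.Equiv.refl _⟩
      symm := fun ⟨e⟩ => ⟨e.symm⟩
      trans := fun ⟨e⟩ ⟨f⟩ => ⟨e.trans f⟩ }

/-- The isomorphism classes of irreducible representations of `Γ` that occur in `π`. -/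
def IrrepClass (π : Representation ℂ Γ V) : Type _ := Quotient (irredSubSetoid π)

theorem IrredSub.isAtom {π : Representation ℂ Γ V} (W : IrredSub π) : IsAtom W.1 := by
  obtain ⟨W, hW⟩ := W
  have : IsSimpleOrder (Subrepresentation W.toRepresentation) := hW
  have key : ∀ U : Subrepresentation π, U ≤ W → U = ⊥ ∨ U = W := by
    intro U hU
    let U' : Subrepresentation W.toRepresentation :=
      { toSubmodule := U.toSubmodule.comap W.toSubmodule.subtype
        apply_mem_toSubmodule := fun g v hv => U.apply_mem_toSubmodule g hv }
    rcases eq_bot_or_eq_top U' with h | h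
    · left
      apply le_antisymm _ bot_le
      intro v hv
      have h1 : (⟨v, hU hv⟩ : W.toSubmodule) ∈ U' := hv
      rw [h] at h1
      have h2 : (⟨v, hU hv⟩ : W.toSubmodule) = 0 := h1
      have h3 : v = 0 := congrArg Subtype.val h2
      rw [h3]
      exact (⊥ : Subrepresentation π).toSubmodule.zero_mem
    · right
      apply le_antisymm hU
      intro v hv
      have h1 : (⟨v, hv⟩ : W.toSubmodule) ∈ U' := by
        rw [h]; exact Submodule.mem_top
      exact h1
  refine ⟨?_, ?_⟩
  · intro hbot
    obtain ⟨x, y, hxy⟩ := exists_pair_ne (Subrepresentation W.toRepresentation)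
    apply hxy
    have hz : ∀ v : W.toSubmodule, v = 0 := by
      rintro ⟨v, hv⟩
      have hv' : v ∈ W := hv
      rw [show W = ⊥ from hbot] at hv'
      have : v = 0 := hv'
      exact Subtype.ext this
    apply SetLike.ext
    intro v
    rw [hz v]
    exact ⟨fun _ => y.toSubmodule.zero_mem, fun _ => x.toSubmodule.zero_mem⟩
  · intro U hU
    exact (key U hU.le).resolve_right hU.ne

/-- Only finitely many irreducible representations occur in a finite-dimensional one. -/
instance IrrepClass.instFinite [FiniteDimensional ℂ V] (π : Representation ℂ Γ V) :
    Finite (IrrepClass π) := by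
  have hfin : Module.Finite ℂ π.asModule := inferInstanceAs (Module.Finite ℂ V)
  have : IsNoetherian ℂ π.asModule := inferInstance
  have : IsNoetherian (MonoidAlgebra ℂ Γ) π.asModule := isNoetherian_of_tower ℂ inferInstance
  have simple : ∀ W : IrredSub π,
      IsSimpleModule (MonoidAlgebra ℂ Γ) (Subrepresentation.asSubmodule W.1) := by
    intro W
    rw [isSimpleModule_iff_isAtom]
    exact (Subrepresentation.subrepresentationSubmoduleOrderIso (ρ := π)).isAtom_iff W.1 |>.2
      W.isAtom
  let c : IrredSub π → isotypicComponents (MonoidAlgebra ℂ Γ) π.asModule := fun W =>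
    ⟨isotypicComponent (MonoidAlgebra ℂ Γ) π.asModule (Subrepresentation.asSubmodule W.1),
      ⟨_, simple W, rfl⟩⟩
  have hc : ∀ W W' : IrredSub π, c W = c W' → W ≈ W' := by
    intro W W' h
    have := simple W
    have := simple W'
    have hle : Subrepresentation.asSubmodule W.1 ≤
        isotypicComponent (MonoidAlgebra ℂ Γ) π.asModule (Subrepresentation.asSubmodule W'.1) :=
      (Submodule.le_isotypicComponent _).trans (congrArg Subtype.val h).le
    obtain ⟨e⟩ := isIsotypicOfType_submodule_iff.mp
      (IsIsotypicOfType.isotypicComponent (MonoidAlgebra ℂ Γ) π.asModule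
        (Subrepresentation.asSubmodule W'.1)) _ hle
    have smul_eq : ∀ (U : Subrepresentation π) (g : Γ) (a : ℂ) (v : U.toSubmodule),
        ((MonoidAlgebra.single g a • (⟨v.1, v.2⟩ : Subrepresentation.asSubmodule U) :
          Subrepresentation.asSubmodule U).1 : V) = a • π g v.1 :=
      fun U g a v => Representation.single_smul π a g v.1
    have e_smul : ∀ (g : Γ) (a : ℂ) (v : W.1.toSubmodule) (h : a • π g v.1 ∈ W.1.toSubmodule),
        ((e ⟨a • π g v.1, h⟩).1 : V) = a • π g (e ⟨v.1, v.2⟩).1 := by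
      intro g a v h
      have h1 : (⟨a • π g v.1, h⟩ : Subrepresentation.asSubmodule W.1) =
          MonoidAlgebra.single g a • (⟨v.1, v.2⟩ : Subrepresentation.asSubmodule W.1) :=
        Subtype.ext (smul_eq W.1 g a v).symm
      rw [h1, map_smul]
      exact smul_eq W'.1 g a ⟨(e ⟨v.1, v.2⟩).1, (e ⟨v.1, v.2⟩).2⟩
    let f : W.1.toSubmodule ≃ₗ[ℂ] W'.1.toSubmodule :=
      { toFun := fun v => ⟨(e ⟨v.1, v.2⟩).1, (e ⟨v.1, v.2⟩).2⟩
        invFun := fun v => ⟨(e.symm ⟨v.1, v.2⟩).1, (e.symm ⟨v.1, v.2⟩).2⟩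
        left_inv := fun v => Subtype.ext (congrArg Subtype.val (e.symm_apply_apply ⟨v.1, v.2⟩))
        right_inv := fun v => Subtype.ext (congrArg Subtype.val (e.apply_symm_apply ⟨v.1, v.2⟩))
        map_add' := fun v w => Subtype.ext (congrArg Subtype.val
          (e.map_add ⟨v.1, v.2⟩ ⟨w.1, w.2⟩))
        map_smul' := fun a v => Subtype.ext (by
          have h1 : a • π 1 v.1 = a • v.1 := by rw [map_one]; rfl
          have h2 := e_smul 1 a v (h1 ▸ W.1.toSubmodule.smul_mem a v.2)
          simp only [map_one, Module.End.one_apply] at h2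
          exact h2) }
    refine ⟨Representation.Equiv.mk f fun g => LinearMap.ext fun v => Subtype.ext ?_⟩
    have h2 := e_smul g 1 v (by rw [one_smul]; exact W.1.apply_mem_toSubmodule g v.2)
    simp only [one_smul] at h2
    exact h2
  exact Finite.of_injective
    (fun q : IrrepClass π => c q.out) (fun q q' h => Quotient.out_equiv_out.mp (hc _ _ h))

instance IrrepClass.instFintype [FiniteDimensional ℂ V] (π : Representation ℂ Γ V) :
    Fintype (IrrepClass π) := Fintype.ofFinite _

namespace IrrepClass

variable {π : Representation ℂ Γ V}

/-- A subrepresentation of `π` in the isomorphism class `l`. -/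
def sub (l : IrrepClass π) : Subrepresentation π := (Quotient.out l).1

/-- The irreducible representation `V_l`. -/
def rep (l : IrrepClass π) : Representation ℂ Γ l.sub.toSubmodule := l.sub.toRepresentation

/-- The dimension `d_l` of `V_l`. -/
def dim (l : IrrepClass π) : ℕ := Module.finrank ℂ l.sub.toSubmodule

end IrrepClass

/-- The multiplicity of an irreducible representation `σ` in `π`: the dimension of the space
`Hom_Γ(σ, π)` of intertwining maps. -/
def multiplicity {S : Type*} [AddCommGroup S] [Module ℂ S] (σ : Representation ℂ Γ S)
    (π : Representation ℂ Γ V) : ℕ := Module.finrank ℂ (σ.IntertwiningMap π)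

/-- The restriction of a representation to a subgroup. -/
abbrev restrictTo (K : Subgroup Γ) (π : Representation ℂ Γ V) : Representation ℂ K V :=
  MonoidHom.comp π K.subtype

/-- `r^l_k = min {m^l_k, m_l}`, where `m_l` is the multiplicity of `V_l` in `π` and `m^l_k` the
multiplicity of the irreducible `K`-representation `V_k` in `V_l`. -/
def minMultiplicity {K : Subgroup Γ} {π : Representation ℂ Γ V} (l : IrrepClass π)
    (k : IrrepClass (restrictTo K π)) : ℕ :=
  min (multiplicity k.rep (restrictTo K l.rep)) (multiplicity l.rep π)

/-- `max_k ∑_l d_l r^l_k / d_k`, where `l` and `k` run over the irreducible representations of `Γ`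
and of `K` that occur in `π`. -/
def branchingDenominator [FiniteDimensional ℂ V] (π : Representation ℂ Γ V) (K : Subgroup Γ) : ℝ :=
  ⨆ k : IrrepClass (restrictTo K π),
    ∑ l : IrrepClass π, (l.dim : ℝ) * (minMultiplicity l k : ℝ) / (k.dim : ℝ)

/-- `∑_l d_l min {d_l, m_l}`, where `l` runs over the irreducible representations that occur
in `π`. -/
def groupDenominator [FiniteDimensional ℂ V] (π : Representation ℂ Γ V) : ℝ :=
  ∑ l : IrrepClass π, (l.dim : ℝ) * (min l.dim (multiplicity l.rep π) : ℝ)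

end Reps

/-! ### Covariant families -/

section Covariant

variable {G X H : Type*} [Group G] [NormedAddCommGroup H] [InnerProductSpace ℂ H]

/-- `π` is a (strongly continuous) unitary representation. -/
structure IsUnitaryRep [TopologicalSpace G] (π : Representation ℂ G H) : Prop where
  inner_map_map : ∀ (g : G) (v w : H), ⟪π g v, π g w⟫_ℂ = ⟪v, w⟫_ℂ
  continuous : ∀ v : H, Continuous fun g : G => π g v

/-- `ρ` is a covariant family of probe states: `ρ (g x) = g (ρ x) g⁻¹`. -/
structure IsCovariantFamily [MulAction G X] (π : Representation ℂ G H) (ρ : X → H →L[ℂ] H) :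
    Prop where
  isState : ∀ x, IsState (ρ x)
  covariant : ∀ (g : G) (x : X) (v : H), ρ (g • x) v = π g (ρ x (π g⁻¹ v))

end Covariant

end CovariantEstimation

end

/-! The bound comes from a `G`-invariant operator `S` that dominates the state at the base point and
has trace at most the stated denominator. By covariance and transitivity `S` then dominates every
state of the family. The function x ↦ tr(ρ^x M(E_x)) is a test whose power against the prior is
exactly p_succ, and its integral is at most ∫ tr(S M(E_x)) dμ(x). Tonelli's theorem, applied to μ
and the outcome measure O ↦ tr(S M(O)), turns this into an integral of region volumes, at most V_max
· tr S. Dividing by |X| bounds β (`RegionEstimator.lintegral_pairing_le`,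
`ofReal_minTypeIIError_mul_le`).

To obtain `S` (`exists_invariant_majorant`), note that the state at the base point commutes with the
stabilizer `K`, so it is a positive combination of projections onto mutually orthogonal irreducible
`K`-subspaces `W`. Each projection is replaced by the projection onto the `G`-span `U` of `W`: this
is larger, it commutes with `G`, and the trace grows by the factor dim U / dim W. Now V_λ occurs in
`U` at most m_λ times because `U` lies in `H`, and at most m^λ_μ times because a `G`-map U → V_λ is
determined by its restriction to `W`, a `K`-map. Hence dim U ≤ ∑ d_λ r^λ_μ (`finrank_generate_le`).
-/

noncomputable section

namespace CovariantEstimation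

/-! ### Spaces of intertwining maps and their dimensions -/

section Intertwining

variable {Γ V W V' W' : Type*} [Group Γ] [AddCommGroup V] [Module ℂ V] [AddCommGroup W] [Module ℂ W]
  [AddCommGroup V'] [Module ℂ V'] [AddCommGroup W'] [Module ℂ W']
  {σ : Representation ℂ Γ V} {τ : Representation ℂ Γ W}
  {σ' : Representation ℂ Γ V'} {τ' : Representation ℂ Γ W'}

theorem IntertwiningMap.ext_apply {f g : σ.IntertwiningMap τ} (h : ∀ v, f v = g v) : f = g :=
  DFunLike.ext _ _ h

/-- The linear map underlying an intertwining map, as a linear function of the latter. -/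
def IntertwiningMap.toLinearMapₗ (σ : Representation ℂ Γ V) (τ : Representation ℂ Γ W) :
    σ.IntertwiningMap τ →ₗ[ℂ] V →ₗ[ℂ] W where
  toFun f := f.toLinearMap
  map_add' _ _ := rfl
  map_smul' _ _ := rfl

theorem IntertwiningMap.toLinearMapₗ_injective :
    Function.Injective (IntertwiningMap.toLinearMapₗ σ τ) :=
  Representation.IntertwiningMap.toLinearMap_injective σ τ

instance IntertwiningMap.instFinite [FiniteDimensional ℂ V] [FiniteDimensional ℂ W] :
    Module.Finite ℂ (σ.IntertwiningMap τ) :=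
  Module.Finite.of_injective _ IntertwiningMap.toLinearMapₗ_injective

/-- Composition with an intertwining map on the right. -/
def IntertwiningMap.precomp (τ : Representation ℂ Γ W) (q : σ'.IntertwiningMap σ) :
    σ.IntertwiningMap τ →ₗ[ℂ] σ'.IntertwiningMap τ where
  toFun f := f.comp q
  map_add' _ _ := rfl
  map_smul' _ _ := rfl

/-- Composition with an intertwining map on the left. -/
def IntertwiningMap.postcomp (σ : Representation ℂ Γ V) (i : τ.IntertwiningMap τ') :
    σ.IntertwiningMap τ →ₗ[ℂ] σ.IntertwiningMap τ' where
  toFun f := i.comp f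
  map_add' f g := IntertwiningMap.ext_apply fun v => map_add i (f v) (g v)
  map_smul' c f := IntertwiningMap.ext_apply fun v => map_smul i c (f v)

theorem IntertwiningMap.precomp_injective (q : σ'.IntertwiningMap σ)
    (hq : Function.Surjective q) : Function.Injective (IntertwiningMap.precomp τ q) := by
  intro f g h
  refine IntertwiningMap.ext_apply fun v => ?_
  obtain ⟨w, rfl⟩ := hq v
  exact DFunLike.congr_fun h w

theorem IntertwiningMap.postcomp_injective (i : τ.IntertwiningMap τ')
    (hi : Function.Injective i) : Function.Injective (IntertwiningMap.postcomp σ i) := by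
  intro f g h
  exact IntertwiningMap.ext_apply fun v => hi (DFunLike.congr_fun h v)

/-- Used to count multiplicities: splitting off one irreducible summand produces one intertwining
map that does not come from the rest. -/
theorem finrank_lt_of_injective_of_notMem_range {A B : Type*} [AddCommGroup A] [Module ℂ A]
    [AddCommGroup B] [Module ℂ B] [FiniteDimensional ℂ B] (f : A →ₗ[ℂ] B)
    (hf : Function.Injective f) (b : B) (hb : b ∉ LinearMap.range f) :
    Module.finrank ℂ A + 1 ≤ Module.finrank ℂ B := by
  rw [← LinearMap.finrank_range_of_inj hf]
  exact Submodule.finrank_lt fun h => hb (h ▸ Submodule.mem_top)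

theorem finrank_intertwiningMap_congr_left (e : σ.Equiv σ') [FiniteDimensional ℂ V]
    [FiniteDimensional ℂ V'] [FiniteDimensional ℂ W] :
    Module.finrank ℂ (σ.IntertwiningMap τ) = Module.finrank ℂ (σ'.IntertwiningMap τ) := by
  apply le_antisymm
  · exact LinearMap.finrank_le_finrank_of_injective
      (IntertwiningMap.precomp_injective (τ := τ) e.symm.toIntertwiningMap e.symm.surjective)
  · exact LinearMap.finrank_le_finrank_of_injective
      (IntertwiningMap.precomp_injective (τ := τ) e.toIntertwiningMap e.surjective)

end Intertwining

/-! ### Subrepresentations of unitary representations and the size of generated ones -/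

section Unitary

variable {Γ H : Type*} [Group Γ] [NormedAddCommGroup H] [InnerProductSpace ℂ H]
  {π : Representation ℂ Γ H}

/-- The inclusion of a subrepresentation in a larger one. -/
def Subrep.inclusion {W U : Subrepresentation π} (h : W ≤ U) :
    W.toRepresentation.IntertwiningMap U.toRepresentation where
  toLinearMap := Submodule.inclusion h
  isIntertwining' _ := rfl

/-- The inclusion of a subrepresentation. -/
def Subrep.subtype (U : Subrepresentation π) : U.toRepresentation.IntertwiningMap π where
  toLinearMap := U.toSubmodule.subtype
  isIntertwining' _ := rfl

/-- The orthogonal complement of a subrepresentation. -/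
def Subrep.orthogonal (hπ : ∀ (g : Γ) (v w : H), ⟪π g v, π g w⟫_ℂ = ⟪v, w⟫_ℂ)
    (W : Subrepresentation π) : Subrepresentation π where
  toSubmodule := W.toSubmoduleᗮ
  apply_mem_toSubmodule g v hv := by
    rw [Submodule.mem_orthogonal] at hv ⊢
    intro u hu
    have h := hπ g (π g⁻¹ u) v
    rw [Representation.self_inv_apply] at h
    rw [h]
    exact hv _ (W.apply_mem_toSubmodule g⁻¹ hu)

theorem exists_equiv_rep (W : Subrepresentation π) (hW : W.toRepresentation.IsIrreducible) :
    ∃ l : IrrepClass π, Nonempty (W.toRepresentation.Equiv l.rep) := by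
  let w : IrredSub π := ⟨W, hW⟩
  exact ⟨Quotient.mk _ w, Setoid.symm (Quotient.mk_out w)⟩

/-- The subrepresentation generated by a subspace. -/
def Subrep.generate (π : Representation ℂ Γ H) (W : Submodule ℂ H) : Subrepresentation π where
  toSubmodule := ⨆ g : Γ, W.map (π g)
  apply_mem_toSubmodule g v hv := by
    have h : (⨆ g : Γ, W.map (π g)) ≤ (⨆ g : Γ, W.map (π g)).comap (π g) := by
      refine iSup_le fun g' => ?_
      rintro _ ⟨w, hw, rfl⟩
      have h2 : π (g * g') w ∈ ⨆ g : Γ, W.map (π g) :=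
        Submodule.mem_iSup_of_mem (g * g') ⟨w, hw, rfl⟩
      rwa [map_mul] at h2
    exact h hv

theorem Subrep.le_generate (W : Submodule ℂ H) : W ≤ (Subrep.generate π W).toSubmodule := by
  intro w hw
  refine Submodule.mem_iSup_of_mem (1 : Γ) ⟨w, hw, ?_⟩
  simp

theorem Subrep.generate_le (W : Submodule ℂ H) (U : Subrepresentation π)
    (h : W ≤ U.toSubmodule) : (Subrep.generate π W).toSubmodule ≤ U.toSubmodule := by
  refine iSup_le fun g => ?_
  rintro _ ⟨w, hw, rfl⟩
  exact U.apply_mem_toSubmodule g (h hw)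

variable [FiniteDimensional ℂ H]

/-- Unitarity makes the orthogonal complement stable as well, so the group preserves the
decomposition of a vector into its two components. -/
theorem starProjection_comm (hπ : ∀ (g : Γ) (v w : H), ⟪π g v, π g w⟫_ℂ = ⟪v, w⟫_ℂ)
    (W : Subrepresentation π) (g : Γ) (v : H) :
    W.toSubmodule.starProjection (π g v) = π g (W.toSubmodule.starProjection v) := by
  apply Submodule.eq_starProjection_of_mem_of_inner_eq_zero
  · exact W.apply_mem_toSubmodule g (Submodule.starProjection_apply_mem _ v)
  · intro w hw
    rw [← map_sub]
    exact Submodule.inner_left_of_mem_orthogonal hw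
      ((Subrep.orthogonal hπ W).apply_mem_toSubmodule g
        (Submodule.sub_starProjection_mem_orthogonal v))

/-- The orthogonal projection of a subrepresentation onto a smaller one. -/
def Subrep.proj (hπ : ∀ (g : Γ) (v w : H), ⟪π g v, π g w⟫_ℂ = ⟪v, w⟫_ℂ)
    (W U : Subrepresentation π) :
    U.toRepresentation.IntertwiningMap W.toRepresentation where
  toLinearMap := ((W.toSubmodule.starProjection : H →ₗ[ℂ] H).codRestrict W.toSubmodule
    fun v => Submodule.starProjection_apply_mem _ v) ∘ₗ U.toSubmodule.subtype
  isIntertwining' g := LinearMap.ext fun v => Subtype.ext (starProjection_comm hπ W g v.1)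

/-- Finite dimension makes the lattice of subrepresentations well-founded, hence atomic; an atom is
irreducible because subrepresentations of `W` are subrepresentations of `π` below `W`. -/
theorem exists_irreducible_le (U : Subrepresentation π) (hU : U.toSubmodule ≠ ⊥) :
    ∃ W : Subrepresentation π, W ≤ U ∧ W.toRepresentation.IsIrreducible := by
  have hwf : WellFoundedLT (Subrepresentation π) := by
    have hmono : StrictMono (Subrepresentation.toSubmodule : Subrepresentation π → _) :=
      Monotone.strictMono_of_injective (fun _ _ h => h) Subrepresentation.toSubmodule_injective
    exact hmono.wellFoundedLT
  obtain h | ⟨W, hW, hWU⟩ := (isAtomic_of_orderBot_wellFounded_lt hwf.wf).eq_bot_or_exists_atom_le U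
  · exact absurd (congrArg Subrepresentation.toSubmodule h) hU
  refine ⟨W, hWU, ?_⟩
  have hWbot : W.toSubmodule ≠ ⊥ := fun h => hW.1 (Subrepresentation.toSubmodule_injective h)
  have : Nontrivial (Subrepresentation W.toRepresentation) := by
    refine ⟨⊥, ⊤, fun h => hWbot ?_⟩
    have h' : (⊥ : Submodule ℂ W.toSubmodule) = ⊤ := congrArg Subrepresentation.toSubmodule h
    rw [Submodule.eq_bot_iff]
    intro v hv
    have : (⟨v, hv⟩ : W.toSubmodule) ∈ (⊥ : Submodule ℂ W.toSubmodule) := h' ▸ Submodule.mem_top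
    exact congrArg Subtype.val ((Submodule.mem_bot ℂ).mp this)
  refine ⟨fun A => ?_⟩
  let A' : Subrepresentation π :=
    { toSubmodule := A.toSubmodule.map W.toSubmodule.subtype
      apply_mem_toSubmodule := by
        rintro g _ ⟨v, hv, rfl⟩
        exact ⟨_, A.apply_mem_toSubmodule g hv, rfl⟩ }
  have hA' : A' ≤ W := by
    rintro _ ⟨v, -, rfl⟩
    exact v.2
  have hmem : ∀ v : W.toSubmodule, v ∈ A.toSubmodule ↔ (v : H) ∈ A'.toSubmodule := by
    intro v
    refine ⟨fun hv => ⟨v, hv, rfl⟩, ?_⟩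
    rintro ⟨w, hw, hwv⟩
    rwa [← Subtype.ext hwv]
  rcases hW.le_iff.mp hA' with h | h
  · left
    apply Subrepresentation.toSubmodule_injective
    change A.toSubmodule = ⊥
    rw [Submodule.eq_bot_iff]
    intro v hv
    rw [hmem, h] at hv
    exact Subtype.ext ((Submodule.mem_bot ℂ).mp hv)
  · right
    apply Subrepresentation.toSubmodule_injective
    change A.toSubmodule = ⊤
    rw [Submodule.eq_top_iff']
    intro v
    rw [hmem, h]
    exact v.2

/-- The dimension of a subrepresentation is a sum of dimensions of irreducible representations,
each counted at most as often as the spaces of intertwining maps allow. -/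
theorem exists_finrank_eq_sum (hπ : ∀ (g : Γ) (v w : H), ⟪π g v, π g w⟫_ℂ = ⟪v, w⟫_ℂ)
    (U : Subrepresentation π) :
    ∃ c : IrrepClass π → ℕ, Module.finrank ℂ U.toSubmodule = ∑ l, l.dim * c l ∧
      ∀ l, c l ≤ Module.finrank ℂ (U.toRepresentation.IntertwiningMap l.rep) ∧
        c l ≤ Module.finrank ℂ (l.rep.IntertwiningMap U.toRepresentation) := by
  classical
  induction hn : Module.finrank ℂ U.toSubmodule using Nat.strong_induction_on generalizing U with
  | _ n ih =>
  by_cases hU : U.toSubmodule = ⊥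
  · refine ⟨0, ?_, fun l => ⟨Nat.zero_le _, Nat.zero_le _⟩⟩
    rw [← hn, hU]
    simp
  obtain ⟨W, hWU, hW⟩ := exists_irreducible_le U hU
  obtain ⟨l₀, ⟨e⟩⟩ := exists_equiv_rep W hW
  -- The orthogonal complement of `W` inside `U`, to which the induction hypothesis applies.
  set U' : Subrepresentation π := Subrep.orthogonal hπ W ⊓ U
  have hU'U : U' ≤ U := fun v hv => hv.2
  have hdim : Module.finrank ℂ W.toSubmodule + Module.finrank ℂ U'.toSubmodule =
      Module.finrank ℂ U.toSubmodule := Submodule.finrank_add_inf_finrank_orthogonal hWU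
  have hdimW : Module.finrank ℂ W.toSubmodule = l₀.dim := e.toLinearEquiv.finrank_eq
  obtain ⟨w, hw, hw0⟩ : ∃ w ∈ W.toSubmodule, w ≠ 0 := by
    apply Submodule.exists_mem_ne_zero_of_ne_bot
    exact fun h => (IrredSub.isAtom ⟨W, hW⟩).1 (Subrepresentation.toSubmodule_injective h)
  have hWpos : 0 < Module.finrank ℂ W.toSubmodule := by
    have : Nontrivial W.toSubmodule := ⟨⟨w, hw⟩, 0, fun h => hw0 (congrArg Subtype.val h)⟩
    exact Module.finrank_pos
  obtain ⟨c, hc, hcl⟩ := ih _ (by omega) U' rfl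
  have projW_of_mem : ∀ v ∈ W.toSubmodule, W.toSubmodule.starProjection v = v :=
    fun v hv => Submodule.starProjection_eq_self_iff.mpr hv
  have projW_of_mem' : ∀ v ∈ U'.toSubmodule, W.toSubmodule.starProjection v = 0 :=
    fun v hv => (Submodule.starProjection_apply_eq_zero_iff _).mpr hv.1
  have projU'_of_mem : ∀ v ∈ U'.toSubmodule, U'.toSubmodule.starProjection v = v :=
    fun v hv => Submodule.starProjection_eq_self_iff.mpr hv
  have projU'_of_mem' : ∀ v ∈ W.toSubmodule, U'.toSubmodule.starProjection v = 0 :=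
    fun v hv => (Submodule.starProjection_apply_eq_zero_iff _).mpr fun u hu =>
      Submodule.inner_left_of_mem_orthogonal hv hu.1
  let qU' := Subrep.proj hπ U' U
  let iU' := Subrep.inclusion hU'U
  have hq : Function.Surjective qU' := fun v =>
    ⟨⟨v.1, hU'U v.2⟩, Subtype.ext (projU'_of_mem v.1 v.2)⟩
  have hi : Function.Injective iU' := Submodule.inclusion_injective hU'U
  refine ⟨fun l => c l + if l = l₀ then 1 else 0, ?_, fun l => ?_⟩
  · simp only [mul_add, Finset.sum_add_distrib, mul_ite, mul_one, mul_zero, Finset.sum_ite_eq',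
      Finset.mem_univ, if_true]
    omega
  · by_cases hl : l = l₀
    · subst hl
      simp only [if_true]
      constructor
      -- Maps factoring through the projection onto `U'` kill `w`, whereas the projection onto `W`
      -- followed by `e` does not, so the space of maps out of `U` has at least one more dimension.
      · refine le_trans (Nat.add_le_add_right (hcl l).1 1)
          (finrank_lt_of_injective_of_notMem_range (IntertwiningMap.precomp l.rep qU')
            (IntertwiningMap.precomp_injective qU' hq)
            (e.toIntertwiningMap.comp (Subrep.proj hπ W U)) ?_)
        rintro ⟨f, hf⟩
        have h1 : f (qU' ⟨w, hWU hw⟩) = e (Subrep.proj hπ W U ⟨w, hWU hw⟩) :=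
          DFunLike.congr_fun hf ⟨w, hWU hw⟩
        have h2 : qU' ⟨w, hWU hw⟩ = 0 := Subtype.ext (projU'_of_mem' w hw)
        have h3 : Subrep.proj hπ W U ⟨w, hWU hw⟩ = ⟨w, hw⟩ := Subtype.ext (projW_of_mem w hw)
        rw [h2, map_zero, h3] at h1
        have h4 : (⟨w, hw⟩ : W.toSubmodule) = 0 := e.toLinearEquiv.map_eq_zero_iff.mp h1.symm
        exact hw0 (congrArg Subtype.val h4)
      -- Dually, maps into `U'` have image orthogonal to `W`, whereas the inverse of `e` followed by
      -- the inclusion hits `w`.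
      · refine le_trans (Nat.add_le_add_right (hcl l).2 1)
          (finrank_lt_of_injective_of_notMem_range (IntertwiningMap.postcomp l.rep iU')
            (IntertwiningMap.postcomp_injective iU' hi)
            ((Subrep.inclusion hWU).comp e.symm.toIntertwiningMap) ?_)
        rintro ⟨f, hf⟩
        have h1 : iU' (f (e ⟨w, hw⟩)) = Subrep.inclusion hWU (e.symm (e ⟨w, hw⟩)) :=
          DFunLike.congr_fun hf (e ⟨w, hw⟩)
        rw [e.symm_apply_apply] at h1
        have h2 : ((f (e ⟨w, hw⟩)).1 : H) = w := congrArg Subtype.val h1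
        have h3 := projW_of_mem' _ (f (e ⟨w, hw⟩)).2
        rw [h2, projW_of_mem w hw] at h3
        exact hw0 h3
    · simp only [hl, if_false, add_zero]
      exact ⟨(hcl l).1.trans (LinearMap.finrank_le_finrank_of_injective
          (IntertwiningMap.precomp_injective (τ := l.rep) qU' hq)),
        (hcl l).2.trans (LinearMap.finrank_le_finrank_of_injective
          (IntertwiningMap.postcomp_injective (σ := l.rep) iU' hi))⟩

/-- An intertwining map on the subrepresentation generated by `W` is determined by its restriction
to `W`. -/
theorem finrank_intertwiningMap_generate_le {K : Subgroup Γ} {V : Type*} [AddCommGroup V]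
    [Module ℂ V] [FiniteDimensional ℂ V] (τ : Representation ℂ Γ V)
    (W : Subrepresentation (restrictTo K π)) :
    Module.finrank ℂ ((Subrep.generate π W.toSubmodule).toRepresentation.IntertwiningMap τ) ≤
      Module.finrank ℂ (W.toRepresentation.IntertwiningMap (restrictTo K τ)) := by
  let U := Subrep.generate π W.toSubmodule
  let i : W.toSubmodule →ₗ[ℂ] U.toSubmodule := Submodule.inclusion (Subrep.le_generate _)
  let res : U.toRepresentation.IntertwiningMap τ →ₗ[ℂ]
      W.toRepresentation.IntertwiningMap (restrictTo K τ) :=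
    { toFun := fun f =>
        { toLinearMap := f.toLinearMap ∘ₗ i
          isIntertwining' := fun g => LinearMap.ext fun v => f.isIntertwining _ _ g.1 (i v) }
      map_add' := fun _ _ => rfl
      map_smul' := fun _ _ => rfl }
  refine LinearMap.finrank_le_finrank_of_injective (f := res) ?_
  rw [injective_iff_map_eq_zero]
  intro f hf
  -- The kernel of `f`, seen inside `H`, is stable under the whole group and contains `W`, so it
  -- contains everything that `W` generates.
  let N : Subrepresentation π :=
    { toSubmodule := f.ker.toSubmodule.map U.toSubmodule.subtype
      apply_mem_toSubmodule := by
        rintro g _ ⟨v, hv, rfl⟩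
        exact ⟨_, f.ker.apply_mem_toSubmodule g hv, rfl⟩ }
  have hWN : W.toSubmodule ≤ N.toSubmodule := fun w hw =>
    ⟨i ⟨w, hw⟩, show f (i ⟨w, hw⟩) = 0 from
      DFunLike.congr_fun hf (⟨w, hw⟩ : W.toSubmodule), rfl⟩
  refine IntertwiningMap.ext_apply fun v => ?_
  obtain ⟨u, hu, huv⟩ := Subrep.generate_le _ N hWN v.2
  have : u = v := Subtype.ext huv
  rw [← this]
  exact hu

/-- The subrepresentation generated by an irreducible representation `W` of a subgroup has
dimension at most `∑ d_l r^l_k`. -/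
theorem finrank_generate_le (hπ : ∀ (g : Γ) (v w : H), ⟪π g v, π g w⟫_ℂ = ⟪v, w⟫_ℂ)
    {K : Subgroup Γ} (W : Subrepresentation (restrictTo K π)) (k : IrrepClass (restrictTo K π))
    (e : W.toRepresentation.Equiv k.rep) :
    Module.finrank ℂ (Subrep.generate π W.toSubmodule).toSubmodule ≤
      ∑ l : IrrepClass π, l.dim * minMultiplicity l k := by
  obtain ⟨c, hc, hcl⟩ := exists_finrank_eq_sum hπ (Subrep.generate π W.toSubmodule)
  rw [hc]
  -- Maps out of the generated space restrict injectively to `W`, which gives m^l_k; maps into it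
  -- are maps into `H`, which gives m_l.
  refine Finset.sum_le_sum fun l _ => Nat.mul_le_mul_left _ (le_min ?_ ?_)
  · refine (hcl l).1.trans ((finrank_intertwiningMap_generate_le l.rep W).trans ?_)
    exact (finrank_intertwiningMap_congr_left e).le
  · exact (hcl l).2.trans (LinearMap.finrank_le_finrank_of_injective
      (IntertwiningMap.postcomp_injective (σ := l.rep) (Subrep.subtype _) Subtype.val_injective))

end Unitary

/-! ### Comparison of the two denominators -/

section Denominators

variable {Γ V : Type*} [Group Γ] [AddCommGroup V] [Module ℂ V] [FiniteDimensional ℂ V]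

theorem IrrepClass.dim_pos {π : Representation ℂ Γ V} (l : IrrepClass π) : 0 < l.dim := by
  have hne : l.sub.toSubmodule ≠ ⊥ := fun h =>
    (Quotient.out l).isAtom.1 (Subrepresentation.toSubmodule_injective h)
  have := Submodule.nontrivial_iff_ne_bot.mpr hne
  exact Module.finrank_pos

/-- Intertwining maps form a subspace of all linear maps, which have dimension d_k d_l, and d_k ≥ 1
allows d_k to be inserted in the other entry of the minimum. After division by d_k this makes the
group denominator a valid constant for every subgroup. -/
theorem minMultiplicity_le {K : Subgroup Γ} {π : Representation ℂ Γ V} (l : IrrepClass π)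
    (k : IrrepClass (restrictTo K π)) :
    minMultiplicity l k ≤ k.dim * min l.dim (multiplicity l.rep π) := by
  have h1 : multiplicity k.rep (restrictTo K l.rep) ≤ k.dim * l.dim := by
    refine (LinearMap.finrank_le_finrank_of_injective
      (IntertwiningMap.toLinearMapₗ_injective (σ := k.rep) (τ := restrictTo K l.rep))).trans ?_
    rw [Module.finrank_linearMap]
    exact le_rfl
  rw [← Nat.mul_min_mul_left, minMultiplicity]
  exact min_le_min h1 (Nat.le_mul_of_pos_left _ k.dim_pos)

theorem sum_minMultiplicity_le_groupDenominator {K : Subgroup Γ} {π : Representation ℂ Γ V}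
    (k : IrrepClass (restrictTo K π)) :
    ∑ l : IrrepClass π, (l.dim : ℝ) * (minMultiplicity l k : ℝ) / (k.dim : ℝ) ≤
      groupDenominator π := by
  refine Finset.sum_le_sum fun l _ => ?_
  have hk : (0 : ℝ) < k.dim := by exact_mod_cast k.dim_pos
  rw [div_le_iff₀ hk, mul_assoc]
  refine mul_le_mul_of_nonneg_left ?_ (Nat.cast_nonneg _)
  rw [mul_comm]
  exact_mod_cast minMultiplicity_le l k

theorem sum_minMultiplicity_le_branchingDenominator {K : Subgroup Γ} {π : Representation ℂ Γ V}
    (k : IrrepClass (restrictTo K π)) :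
    ∑ l : IrrepClass π, (l.dim : ℝ) * (minMultiplicity l k : ℝ) / (k.dim : ℝ) ≤
      branchingDenominator π K :=
  le_ciSup (f := fun k : IrrepClass (restrictTo K π) =>
    ∑ l : IrrepClass π, (l.dim : ℝ) * (minMultiplicity l k : ℝ) / (k.dim : ℝ))
    (Set.finite_range _).bddAbove k

end Denominators

/-! ### The trace pairing -/

section Pairing

variable {H : Type*} [NormedAddCommGroup H] [InnerProductSpace ℂ H]

theorem pairing_sub_left (A A' B : H →L[ℂ] H) :
    pairing (A - A') B = pairing A B - pairing A' B := by
  simp [pairing, ContinuousLinearMap.sub_comp]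

theorem pairing_sub_right (A B B' : H →L[ℂ] H) :
    pairing A (B - B') = pairing A B - pairing A B' := by
  simp [pairing, ContinuousLinearMap.comp_sub]

theorem pairing_add_right (A B B' : H →L[ℂ] H) :
    pairing A (B + B') = pairing A B + pairing A B' := by
  simp [pairing, ContinuousLinearMap.comp_add]

@[simp] theorem pairing_zero_right (A : H →L[ℂ] H) : pairing A 0 = 0 := by
  simp [pairing]

theorem pairing_id (A : H →L[ℂ] H) :
    pairing A (ContinuousLinearMap.id ℂ H) = (LinearMap.trace ℂ H (A : H →ₗ[ℂ] H)).re := by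
  simp [pairing]

variable [FiniteDimensional ℂ H]

/-- Writing `B` as a sum of rank-one operators |u_i⟩⟨u_i| turns the trace into ∑ ⟨u_i, A u_i⟩. -/
theorem pairing_nonneg {A B : H →L[ℂ] H} (hA : A.IsPositive) (hB : B.IsPositive) :
    0 ≤ pairing A B := by
  have := FiniteDimensional.complete ℂ H
  obtain ⟨m, u, rfl⟩ := ContinuousLinearMap.isPositive_iff_eq_sum_rankOne.mp hB
  have h : ∀ i, A ∘L InnerProductSpace.rankOne ℂ (u i) (u i) =
      InnerProductSpace.rankOne ℂ (A (u i)) (u i) := fun i => by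
    ext v
    simp
  have h2 : pairing A (∑ i, InnerProductSpace.rankOne ℂ (u i) (u i)) =
      ∑ i, (⟪u i, A (u i)⟫_ℂ).re := by
    rw [pairing, ContinuousLinearMap.comp_finsetSum]
    simp only [h, ContinuousLinearMap.toLinearMap_sum, map_sum, Complex.re_sum,
      InnerProductSpace.trace_rankOne]
  rw [h2]
  exact Finset.sum_nonneg fun i _ => hA.re_inner_nonneg_right (u i)

theorem continuous_pairing : Continuous fun q : (H →L[ℂ] H) × (H →L[ℂ] H) => pairing q.1 q.2 := by
  have h : Continuous fun A : H →L[ℂ] H => LinearMap.trace ℂ H (A : H →ₗ[ℂ] H) :=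
    ((LinearMap.trace ℂ H) ∘ₗ ContinuousLinearMap.coeLM ℂ).continuous_of_finiteDimensional
  exact Complex.continuous_re.comp (h.comp (continuous_fst.clm_comp continuous_snd))

end Pairing

/-! ### The invariant majorant -/

section Majorant

variable {Γ H : Type*} [Group Γ] [NormedAddCommGroup H] [InnerProductSpace ℂ H]
  [FiniteDimensional ℂ H] {π : Representation ℂ Γ H}

theorem exists_pos_eigenvector {T : H →L[ℂ] H} (hT : T.IsPositive) (h0 : T ≠ 0) :
    ∃ (a : ℝ) (v : H), 0 < a ∧ v ≠ 0 ∧ T v = (a : ℂ) • v := by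
  have hT' : (T : H →ₗ[ℂ] H).IsPositive := hT
  by_contra! hcon
  apply h0
  have hb := hT'.isSymmetric.apply_eigenvectorBasis rfl
  have key : (T : H →ₗ[ℂ] H) = 0 := by
    refine (hT'.isSymmetric.eigenvectorBasis rfl).toBasis.ext fun i => ?_
    rw [OrthonormalBasis.coe_toBasis, hb, LinearMap.zero_apply]
    rcases (hT'.nonneg_eigenvalues rfl i).eq_or_lt with h | h
    · rw [← h]
      simp
    · exact absurd (hb i) (hcon _ _ h ((hT'.isSymmetric.eigenvectorBasis rfl).toBasis.ne_zero i))
  exact ContinuousLinearMap.coe_injective key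

theorem trace_starProjection (W : Submodule ℂ H) :
    LinearMap.trace ℂ H (W.starProjection : H →ₗ[ℂ] H) = Module.finrank ℂ W := by
  have h : LinearMap.IsProj W (W.starProjection : H →ₗ[ℂ] H) :=
    ⟨fun v => Submodule.starProjection_apply_mem _ v,
      fun v hv => Submodule.starProjection_eq_self_iff.mpr hv⟩
  exact h.trace

/-- `C` thus bounds the factor by which the trace grows when the projection onto `W` is replaced by
the projection onto its `Γ`-span. -/
theorem finrank_generate_le_mul (hπ : ∀ (g : Γ) (v w : H), ⟪π g v, π g w⟫_ℂ = ⟪v, w⟫_ℂ)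
    {K : Subgroup Γ} {C : ℝ}
    (hC : ∀ k : IrrepClass (restrictTo K π),
      ∑ l : IrrepClass π, (l.dim : ℝ) * (minMultiplicity l k : ℝ) / (k.dim : ℝ) ≤ C)
    (W : Subrepresentation (restrictTo K π)) (hW : W.toRepresentation.IsIrreducible) :
    (Module.finrank ℂ (Subrep.generate π W.toSubmodule).toSubmodule : ℝ) ≤
      C * Module.finrank ℂ W.toSubmodule := by
  obtain ⟨k, ⟨e⟩⟩ := exists_equiv_rep W hW
  have hk : (0 : ℝ) < k.dim := by exact_mod_cast k.dim_pos
  have hdim : Module.finrank ℂ W.toSubmodule = k.dim := e.toLinearEquiv.finrank_eq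
  have h1 := hC k
  rw [← Finset.sum_div, div_le_iff₀ hk] at h1
  rw [hdim]
  refine le_trans ?_ h1
  exact_mod_cast finrank_generate_le hπ W k e

open scoped ComplexOrder in
/-- A positive operator that commutes with a subgroup `K` is dominated by a positive operator
that commutes with the whole group and has not much larger trace. -/
theorem exists_invariant_majorant
    (hπ : ∀ (g : Γ) (v w : H), ⟪π g v, π g w⟫_ℂ = ⟪v, w⟫_ℂ) {K : Subgroup Γ} {C : ℝ}
    (hC : ∀ k : IrrepClass (restrictTo K π),
      ∑ l : IrrepClass π, (l.dim : ℝ) * (minMultiplicity l k : ℝ) / (k.dim : ℝ) ≤ C)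
    (T : H →L[ℂ] H) (hT : T.IsPositive) (hTK : ∀ g ∈ K, ∀ v, T (π g v) = π g (T v)) :
    ∃ S : H →L[ℂ] H, S.IsPositive ∧ (∀ g v, S (π g v) = π g (S v)) ∧ (S - T).IsPositive ∧
      (LinearMap.trace ℂ H (S : H →ₗ[ℂ] H)).re ≤
        C * (LinearMap.trace ℂ H (T : H →ₗ[ℂ] H)).re := by
  have := FiniteDimensional.complete ℂ H
  -- Induction on the rank: each step splits off from `T` an irreducible `K`-subspace of an
  -- eigenspace with positive eigenvalue.
  induction hn : Module.finrank ℂ (LinearMap.range (T : H →ₗ[ℂ] H)) using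
    Nat.strong_induction_on generalizing T with
  | _ n ih =>
  by_cases h0 : T = 0
  · subst h0
    refine ⟨0, hT, fun g v => by simp, by simp, by simp⟩
  obtain ⟨a, v, ha, hv, hTv⟩ := exists_pos_eigenvector hT h0
  have ha' : (a : ℂ) ≠ 0 := by exact_mod_cast ha.ne'
  let E : Subrepresentation (restrictTo K π) :=
    { toSubmodule := Module.End.eigenspace (T : H →ₗ[ℂ] H) (a : ℂ)
      apply_mem_toSubmodule := fun g w hw => by
        rw [Module.End.mem_eigenspace_iff] at hw ⊢
        have h1 : T (π g w) = π g (T w) := hTK g g.2 w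
        have h2 : T w = (a : ℂ) • w := hw
        change T (π g w) = (a : ℂ) • π g w
        rw [h1, h2, map_smul] }
  obtain ⟨W, hWE, hW⟩ := exists_irreducible_le E fun h => hv <| by
    have : v ∈ E.toSubmodule := Module.End.mem_eigenspace_iff.mpr hTv
    rw [h] at this
    exact (Submodule.mem_bot ℂ).mp this
  have hTW : ∀ w ∈ W.toSubmodule, T w = (a : ℂ) • w :=
    fun w hw => Module.End.mem_eigenspace_iff.mp (hWE hw)
  obtain ⟨w, hw, hw0⟩ : ∃ w ∈ W.toSubmodule, w ≠ 0 :=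
    Submodule.exists_mem_ne_zero_of_ne_bot
      fun h => (IrredSub.isAtom ⟨W, hW⟩).1 (Subrepresentation.toSubmodule_injective h)
  have hT_orth : ∀ u ∈ W.toSubmoduleᗮ, T u ∈ W.toSubmoduleᗮ := by
    intro u hu
    rw [Submodule.mem_orthogonal] at hu ⊢
    intro w hw
    rw [← hT.inner_left_eq_inner_right, hTW w hw, inner_smul_left, hu w hw, mul_zero]
  let P := W.toSubmodule.starProjection
  let T' : H →L[ℂ] H := T - (a : ℂ) • P
  have hT'_eq : ∀ v, T' v = T (v - P v) := fun v => by
    rw [map_sub, hTW _ (Submodule.starProjection_apply_mem _ v)]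
    rfl
  have hT'_mem : ∀ v, T' v ∈ W.toSubmoduleᗮ := fun v => by
    rw [hT'_eq]
    exact hT_orth _ (Submodule.sub_starProjection_mem_orthogonal v)
  have hT'pos : T'.IsPositive := by
    -- Since `T` preserves the complement of `W`, `T'` is the compression of `T` to that complement,
    -- which is positive.
    have h1 : T' = W.toSubmoduleᗮ.starProjection ∘L T ∘L W.toSubmoduleᗮ.starProjection := by
      refine ContinuousLinearMap.ext fun v => ?_
      have h2 : W.toSubmoduleᗮ.starProjection v = v - P v := by
        rw [Submodule.starProjection_orthogonal]
        rfl
      change T' v = W.toSubmoduleᗮ.starProjection (T (W.toSubmoduleᗮ.starProjection v))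
      rw [h2, ← hT'_eq]
      exact (Submodule.starProjection_eq_self_iff.mpr (hT'_mem v)).symm
    rw [h1]
    exact hT.conj_starProjection _
  have hT'K : ∀ g ∈ K, ∀ v, T' (π g v) = π g (T' v) := by
    intro g hg v
    have h1 : P (π g v) = π g (P v) :=
      starProjection_comm (fun (g : K) v w => hπ g v w) W ⟨g, hg⟩ v
    rw [hT'_eq, hT'_eq, h1, ← map_sub, hTK g hg]
  have hrank : Module.finrank ℂ (LinearMap.range (T' : H →ₗ[ℂ] H)) < n := by
    rw [← hn]
    apply Submodule.finrank_lt_finrank_of_lt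
    -- The range shrinks strictly: `w` lies in the range of `T` because the eigenvalue is non-zero,
    -- whereas the range of `T'` is orthogonal to `W`.
    refine lt_of_le_of_ne ?_ fun h => hw0 ?_
    · rintro _ ⟨v, rfl⟩
      exact ⟨v - P v, (hT'_eq v).symm⟩
    · have hmem : w ∈ LinearMap.range (T : H →ₗ[ℂ] H) := by
        refine ⟨(a : ℂ)⁻¹ • w, ?_⟩
        change T ((a : ℂ)⁻¹ • w) = w
        rw [map_smul, hTW w hw, inv_smul_smul₀ ha']
      rw [← h] at hmem
      obtain ⟨v, hv⟩ := hmem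
      have h2 : w ∈ W.toSubmoduleᗮ := hv ▸ hT'_mem v
      exact inner_self_eq_zero.mp ((Submodule.mem_orthogonal _ _).mp h2 w hw)
  obtain ⟨S', hS'pos, hS'G, hS'T', hS'tr⟩ := ih _ hrank T' hT'pos hT'K rfl
  set U := Subrep.generate π W.toSubmodule with hU
  let Q := U.toSubmodule.starProjection
  have ha_nonneg : (0 : ℂ) ≤ a := by exact_mod_cast ha.le
  have hQpos : Q.IsPositive := ContinuousLinearMap.IsPositive.of_isStarProjection
    isStarProjection_starProjection
  have hPQ : (Q - P).IsPositive :=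
    Submodule.starProjection_le_starProjection_iff.mpr (Subrep.le_generate _)
  refine ⟨S' + (a : ℂ) • Q, hS'pos.add (hQpos.smul_of_nonneg ha_nonneg), fun g v => ?_, ?_, ?_⟩
  · have h1 : Q (π g v) = π g (Q v) := starProjection_comm hπ U g v
    simp [hS'G, h1]
  · have h1 : S' + (a : ℂ) • Q - T = (S' - T') + (a : ℂ) • (Q - P) := by
      rw [smul_sub]
      simp only [T']
      abel
    rw [h1]
    exact hS'T'.add (hPQ.smul_of_nonneg ha_nonneg)
  · have h1 : LinearMap.trace ℂ H (T : H →ₗ[ℂ] H) =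
        LinearMap.trace ℂ H (T' : H →ₗ[ℂ] H) + a * Module.finrank ℂ W.toSubmodule := by
      rw [← trace_starProjection]
      simp [T', P]
    have h2 : LinearMap.trace ℂ H ((S' + (a : ℂ) • Q : H →L[ℂ] H) : H →ₗ[ℂ] H) =
        LinearMap.trace ℂ H (S' : H →ₗ[ℂ] H) + a * Module.finrank ℂ U.toSubmodule := by
      rw [← trace_starProjection]
      simp [Q]
    have h3 := mul_le_mul_of_nonneg_left (finrank_generate_le_mul hπ hC W hW) ha.le
    rw [h1, h2]
    simp only [Complex.add_re, Complex.mul_re, Complex.ofReal_re, Complex.ofReal_im,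
      Complex.natCast_re, Complex.natCast_im, mul_zero, sub_zero]
    rw [← hU] at h3
    nlinarith

end Majorant

/-! ### Measurements, outcome distributions and the Tonelli argument -/

section Measure

variable {X Y H : Type*} [NormedAddCommGroup H] [InnerProductSpace ℂ H] [MeasurableSpace Y]

theorem POVM.compl (M : POVM Y H) {O : Set Y} (hO : MeasurableSet O) :
    M.toVectorMeasure Oᶜ = ContinuousLinearMap.id ℂ H - M.toVectorMeasure O := by
  rw [← M.univ_eq_one, eq_sub_iff_add_eq, add_comm, ← Set.union_compl_self O]
  exact (VectorMeasure.of_union disjoint_compl_right hO hO.compl).symm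

variable [FiniteDimensional ℂ H]

theorem POVM.pairing_le (M : POVM Y H) {A : H →L[ℂ] H} (hA : A.IsPositive) {O : Set Y}
    (hO : MeasurableSet O) :
    pairing A (M.toVectorMeasure O) ≤ pairing A (ContinuousLinearMap.id ℂ H) := by
  have h := pairing_nonneg hA (M.isPositive _ hO.compl)
  rw [M.compl hO, pairing_sub_right] at h
  linarith

/-- The pairing with an operator as a continuous additive map. -/
def pairingHom (A : H →L[ℂ] H) : (H →L[ℂ] H) →+ ℝ where
  toFun := pairing A
  map_zero' := pairing_zero_right A
  map_add' := pairing_add_right A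

theorem continuous_pairingHom (A : H →L[ℂ] H) : Continuous (pairingHom A) :=
  continuous_pairing.comp (continuous_const.prodMk continuous_id)

/-- The distribution of the outcomes of a measurement of a positive operator. -/
theorem POVM.exists_measure (M : POVM Y H) {A : H →L[ℂ] H} (hA : A.IsPositive) :
    ∃ ν : Measure Y, IsFiniteMeasure ν ∧ ∀ O, MeasurableSet O →
      ν O = ENNReal.ofReal (pairing A (M.toVectorMeasure O)) := by
  let s : SignedMeasure Y := M.toVectorMeasure.mapRange (pairingHom A) (continuous_pairingHom A)
  have hs : 0 ≤[Set.univ] s := by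
    refine VectorMeasure.restrict_le_restrict_of_subset_le _ _ fun O hO _ => ?_
    exact pairing_nonneg hA (M.isPositive O hO)
  refine ⟨s.toMeasureOfZeroLE Set.univ MeasurableSet.univ hs, inferInstance, fun O hO => ?_⟩
  rw [SignedMeasure.toMeasureOfZeroLE_apply s hs MeasurableSet.univ hO, ENNReal.ofReal,
    ENNReal.coe_inj]
  apply NNReal.eq
  rw [Real.coe_toNNReal _ (pairing_nonneg hA (M.isPositive O hO))]
  simp only [Set.univ_inter, NNReal.coe_mk]
  rfl

/-- Both `ρ` and the effect depend on the point, so the claim is proved first for rectangles, where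
the effect is locked to a fixed operator or 0, and extended by the π-λ theorem. Continuity of `ρ`
enters only through fixed effects. -/
theorem POVM.measurable_pairing [TopologicalSpace X] [MeasurableSpace X] [BorelSpace X]
    (M : POVM Y H) {ρ : X → H →L[ℂ] H} (hρ : Continuous ρ) {t : Set (X × Y)}
    (ht : MeasurableSet t) :
    Measurable fun x => pairing (ρ x) (M.toVectorMeasure (Prod.mk x ⁻¹' t)) := by
  have hconst : ∀ B : H →L[ℂ] H, Measurable fun x => pairing (ρ x) B := fun B =>
    (continuous_pairing.comp (hρ.prodMk continuous_const)).measurable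
  induction t, ht using MeasurableSpace.induction_on_inter generateFrom_prod.symm isPiSystem_prod
    with
  | empty => simp
  | basic t ht =>
    classical
    obtain ⟨A, hA, B, hB, rfl⟩ := ht
    have h : (fun x => pairing (ρ x) (M.toVectorMeasure (Prod.mk x ⁻¹' A ×ˢ B))) =
        A.indicator fun x => pairing (ρ x) (M.toVectorMeasure B) := by
      ext x
      by_cases hx : x ∈ A
      · simp [Set.mk_preimage_prod_right hx, hx]
      · simp [Set.mk_preimage_prod_right_eq_empty hx, hx]
    rw [h]
    exact (hconst _).indicator hA
  | compl t ht ih =>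
    have h : (fun x => pairing (ρ x) (M.toVectorMeasure (Prod.mk x ⁻¹' tᶜ))) = fun x =>
        pairing (ρ x) (ContinuousLinearMap.id ℂ H) -
          pairing (ρ x) (M.toVectorMeasure (Prod.mk x ⁻¹' t)) := by
      ext x
      rw [Set.preimage_compl, M.compl (measurable_prodMk_left ht), pairing_sub_right]
    rw [h]
    exact (hconst _).sub ih
  | iUnion f hd hf ih =>
    refine measurable_of_tendsto_metrizable
      (f := fun (n : ℕ) x => ∑ i ∈ Finset.range n,
        pairing (ρ x) (M.toVectorMeasure (Prod.mk x ⁻¹' f i)))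
      (fun n => Finset.measurable_sum _ fun i _ => ih i) ?_
    rw [tendsto_pi_nhds]
    intro x
    rw [Set.preimage_iUnion]
    have h := M.toVectorMeasure.hasSum_of_disjoint_iUnion
      (fun i => measurable_prodMk_left (x := x) (hf i))
      (fun i j hij => (hd hij).preimage (Prod.mk x))
    exact (h.map (pairingHom (ρ x)) (continuous_pairingHom (ρ x))).tendsto_sum_nat

/-- The integrated acceptance probability of a region estimator is at most the maximal volume of
its regions times the trace of an operator that dominates all states. -/
theorem RegionEstimator.lintegral_pairing_le [MeasurableSpace X] (R : RegionEstimator X Y H)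
    (μ : Measure X) [IsFiniteMeasure μ] {ρ : X → H →L[ℂ] H} {S : H →L[ℂ] H}
    (hS : S.IsPositive) (hρS : ∀ x, (S - ρ x).IsPositive) :
    ∫⁻ x, ENNReal.ofReal (pairing (ρ x) (R.povm.toVectorMeasure (R.compatible x))) ∂μ ≤
      R.maxVolume μ * ENNReal.ofReal (LinearMap.trace ℂ H (S : H →ₗ[ℂ] H)).re := by
  obtain ⟨ν, hν, hνO⟩ := R.povm.exists_measure hS
  have hcomp : ∀ x, MeasurableSet (R.compatible x) :=
    fun x => measurable_prodMk_left R.measurableSet_table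
  calc ∫⁻ x, ENNReal.ofReal (pairing (ρ x) (R.povm.toVectorMeasure (R.compatible x))) ∂μ
      ≤ ∫⁻ x, ν (R.compatible x) ∂μ := by
        refine lintegral_mono fun x => ?_
        rw [hνO _ (hcomp x)]
        apply ENNReal.ofReal_le_ofReal
        have h := pairing_nonneg (hρS x) (R.povm.isPositive _ (hcomp x))
        rw [pairing_sub_left] at h
        linarith
    _ = (μ.prod ν) R.table := (Measure.prod_apply R.measurableSet_table).symm
    _ = ∫⁻ y, μ (R.region y) ∂ν := Measure.prod_apply_symm R.measurableSet_table
    _ ≤ ∫⁻ _, R.maxVolume μ ∂ν := lintegral_mono fun y => le_iSup (fun y => μ (R.region y)) y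
    _ = R.maxVolume μ * ENNReal.ofReal (LinearMap.trace ℂ H (S : H →ₗ[ℂ] H)).re := by
        rw [lintegral_const, hνO _ MeasurableSet.univ, R.povm.univ_eq_one, pairing_id]

end Measure

/-! ### Covariant families and the volume bound -/

section Covariant

variable {G X H : Type*} [Group G] [TopologicalSpace G] [IsTopologicalGroup G] [CompactSpace G]
  [TopologicalSpace X] [T2Space X] [MulAction G X] [MulAction.IsPretransitive G X]
  [NormedAddCommGroup H] [InnerProductSpace ℂ H] [FiniteDimensional ℂ H]
  {π : Representation ℂ G H} {ρ : X → H →L[ℂ] H}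

/-- The orbit map is a continuous surjection from a compact space to a Hausdorff one, hence a
quotient map. Continuity can therefore be tested on the group, where covariance expresses `ρ`
through `π`. -/
theorem IsCovariantFamily.continuous (hρ : IsCovariantFamily π ρ) (hπ : IsUnitaryRep π) (x₀ : X)
    (hx₀ : Continuous fun g : G => g • x₀) : Continuous ρ := by
  have hq : Topology.IsQuotientMap fun g : G => g • x₀ :=
    hx₀.isClosedMap.isQuotientMap hx₀ (MulAction.surjective_smul G x₀)
  rw [hq.continuous_iff, continuous_clm_apply]
  intro v
  have hc : Continuous fun g : G => LinearMap.toContinuousLinearMap (π g) :=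
    continuous_clm_apply.mpr hπ.continuous
  have h : (fun g : G => (ρ ∘ fun g : G => g • x₀) g v) = fun g : G =>
      LinearMap.toContinuousLinearMap (π g) (ρ x₀ (π g⁻¹ v)) :=
    funext fun g => hρ.covariant g x₀ v
  rw [h]
  exact hc.clm_apply ((ρ x₀).continuous.comp ((hπ.continuous v).comp continuous_inv))

-- Covariance makes `ρ x₀` commute with the stabilizer. As its majorant `S` commutes with `G`, the
-- difference `S - ρ (g • x₀)` is a unitary conjugate of `S - ρ x₀`, so one inequality yields all of
-- them.
omit [TopologicalSpace X] [T2Space X] [IsTopologicalGroup G] [CompactSpace G] in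
theorem IsCovariantFamily.exists_majorant (hρ : IsCovariantFamily π ρ) (hπ : IsUnitaryRep π)
    (x₀ : X) {C : ℝ}
    (hC : ∀ k : IrrepClass (restrictTo (MulAction.stabilizer G x₀) π),
      ∑ l : IrrepClass π, (l.dim : ℝ) * (minMultiplicity l k : ℝ) / (k.dim : ℝ) ≤ C) :
    ∃ S : H →L[ℂ] H, S.IsPositive ∧ (∀ x, (S - ρ x).IsPositive) ∧
      (LinearMap.trace ℂ H (S : H →ₗ[ℂ] H)).re ≤ C := by
  obtain ⟨S, hS, hSG, hSρ, htr⟩ := exists_invariant_majorant hπ.inner_map_map hC (ρ x₀)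
    (hρ.isState x₀).isPositive fun g hg v => by
      have h := hρ.covariant g x₀ (π g v)
      rwa [MulAction.mem_stabilizer_iff.mp hg, Representation.inv_self_apply] at h
  refine ⟨S, hS, fun x => ?_, ?_⟩
  · obtain ⟨g, rfl⟩ := MulAction.exists_smul_eq G x₀ x
    have key : ∀ v, (S - ρ (g • x₀)) v = π g ((S - ρ x₀) (π g⁻¹ v)) := fun v => by
      rw [sub_apply, sub_apply, map_sub, ← hSG,
        Representation.self_inv_apply, hρ.covariant]
    have hinv : ∀ v w, ⟪π g v, w⟫_ℂ = ⟪v, π g⁻¹ w⟫_ℂ := fun v w => by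
      rw [← hπ.inner_map_map g v, Representation.self_inv_apply]
    have hinv' : ∀ v w, ⟪w, π g v⟫_ℂ = ⟪π g⁻¹ w, v⟫_ℂ := fun v w => by
      rw [← hπ.inner_map_map g _ v, Representation.self_inv_apply]
    refine ⟨fun v w => ?_, fun v => ?_⟩
    · change ⟪(S - ρ (g • x₀)) v, w⟫_ℂ = ⟪v, (S - ρ (g • x₀)) w⟫_ℂ
      rw [key, key, hinv, hinv', hSρ.inner_left_eq_inner_right]
    · change 0 ≤ (⟪(S - ρ (g • x₀)) v, v⟫_ℂ).re
      rw [key, hinv]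
      exact hSρ.re_inner_nonneg_left _
  · rwa [(hρ.isState x₀).trace_eq_one, Complex.one_re, mul_one] at htr

/-- The bound on the maximal volume for a continuous transitive action of a compact group, with
any constant that dominates the branching numbers. -/
theorem ofReal_minTypeIIError_mul_le [MeasurableSpace X] [BorelSpace X]
    (hπ : IsUnitaryRep π) {Y : Type*} [MeasurableSpace Y] (μ : Measure X) [IsFiniteMeasure μ]
    (x₀ : X) (hx₀ : Continuous fun g : G => g • x₀) (p : X → ℝ) (R : RegionEstimator X Y H)
    (hp : IsProbabilityDensity μ p) (hρ : IsCovariantFamily π ρ) {C : ℝ}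
    (hC : ∀ k : IrrepClass (restrictTo (MulAction.stabilizer G x₀) π),
      ∑ l : IrrepClass π, (l.dim : ℝ) * (minMultiplicity l k : ℝ) / (k.dim : ℝ) ≤ C) :
    ENNReal.ofReal (minTypeIIError μ (R.successProb μ p ρ) p (uniformDensity μ) * (1 / C)) ≤
      R.maxVolume μ / μ Set.univ := by
  obtain ⟨S, hS, hρS, htr⟩ := hρ.exists_majorant hπ x₀ hC
  have hstate : ∀ x, pairing (ρ x) (ContinuousLinearMap.id ℂ H) = 1 := fun x => by
    rw [pairing_id, (hρ.isState x).trace_eq_one, Complex.one_re]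
  -- Since `S` dominates a state, 1 ≤ tr S ≤ C.
  have hCpos : 0 < C := by
    have h := pairing_nonneg (hρS x₀) ContinuousLinearMap.isPositive_id
    rw [pairing_sub_left, hstate, pairing_id] at h
    linarith
  have hμ : μ ≠ 0 := by
    rintro rfl
    simpa using hp.integral_eq_one
  have hm : 0 < μ.real Set.univ := by
    rw [measureReal_def]
    exact ENNReal.toReal_pos (Measure.measure_univ_ne_zero.mpr hμ) (measure_ne_top _ _)
  set T : X → ℝ := fun x => pairing (ρ x) (R.povm.toVectorMeasure (R.compatible x))
  have hcomp : ∀ x, MeasurableSet (R.compatible x) :=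
    fun x => measurable_prodMk_left R.measurableSet_table
  have hTmeas : Measurable T :=
    R.povm.measurable_pairing (hρ.continuous hπ x₀ hx₀) R.measurableSet_table
  have hT0 : ∀ x, 0 ≤ T x := fun x =>
    pairing_nonneg (hρ.isState x).isPositive (R.povm.isPositive _ (hcomp x))
  have hT1 : ∀ x, T x ≤ 1 := fun x =>
    (R.povm.pairing_le (hρ.isState x).isPositive (hcomp x)).trans (hstate x).le
  have hβ : minTypeIIError μ (R.successProb μ p ρ) p (uniformDensity μ) ≤
      (∫ x, T x ∂μ) / μ.real Set.univ := by
    -- The power condition holds with equality, as the success probability is the integral of `p`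
    -- times `T`; the 0 is the lower bound that the infimum needs.
    refine csInf_le ⟨0, ?_⟩ ⟨T, hTmeas, fun x => ⟨hT0 x, hT1 x⟩, le_rfl, ?_⟩
    · rintro b ⟨E, -, hE, -, rfl⟩
      exact integral_nonneg fun x => mul_nonneg (by simp only [uniformDensity]; positivity) (hE x).1
    · simp only [uniformDensity]
      rw [integral_const_mul, one_div, div_eq_inv_mul]
  have hTint : Integrable T μ := Integrable.of_bound hTmeas.aestronglyMeasurable 1
    (Filter.Eventually.of_forall fun x => by
      rw [Real.norm_of_nonneg (hT0 x)]
      exact hT1 x)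
  have hI : ENNReal.ofReal (∫ x, T x ∂μ) ≤ R.maxVolume μ * ENNReal.ofReal C := by
    rw [ofReal_integral_eq_lintegral_ofReal hTint (Filter.Eventually.of_forall hT0)]
    exact (R.lintegral_pairing_le μ hS hρS).trans (by gcongr)
  calc ENNReal.ofReal (minTypeIIError μ (R.successProb μ p ρ) p (uniformDensity μ) * (1 / C))
      ≤ ENNReal.ofReal ((∫ x, T x ∂μ) / C / μ.real Set.univ) := by
        apply ENNReal.ofReal_le_ofReal
        rw [div_right_comm, mul_one_div]
        exact div_le_div_of_nonneg_right hβ hCpos.le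
    _ = ENNReal.ofReal (∫ x, T x ∂μ) / ENNReal.ofReal C / μ Set.univ := by
        rw [ENNReal.ofReal_div_of_pos hm, ENNReal.ofReal_div_of_pos hCpos, ofReal_measureReal]
    _ ≤ R.maxVolume μ / μ Set.univ := by
        gcongr
        exact ENNReal.div_le_of_le_mul hI

end Covariant

end CovariantEstimation

end

theorem mainTheorem3
    {E : Type*} [NormedAddCommGroup E] [NormedSpace ℝ E] [FiniteDimensional ℝ E]
    {G : Type*} [TopologicalSpace G] [ChartedSpace E G] [Group G] [LieGroup 𝓘(ℝ, E) ∞ G]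
    [CompactSpace G] [ConnectedSpace G] [T2Space G] [MeasurableSpace G] [BorelSpace G]
    {F : Type*} [NormedAddCommGroup F] [NormedSpace ℝ F] [FiniteDimensional ℝ F]
    {X : Type*} [TopologicalSpace X] [ChartedSpace F X] [IsManifold 𝓘(ℝ, F) ∞ X]
    [T2Space X] [MeasurableSpace X] [BorelSpace X]
    [MulAction G X] [MulAction.IsPretransitive G X]
    (hsmooth : ContMDiff (𝓘(ℝ, E).prod 𝓘(ℝ, F)) 𝓘(ℝ, F) ∞ (fun q : G × X => q.1 • q.2))
    {H : Type*} [NormedAddCommGroup H] [InnerProductSpace ℂ H] [FiniteDimensional ℂ H]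
    (π : Representation ℂ G H) (hπ : CovariantEstimation.IsUnitaryRep π)
    {Y : Type*} [MeasurableSpace Y] :
    (∀ (μ : Measure X) [IsFiniteMeasure μ] [SMulInvariantMeasure G X μ] (x₀ : X)
        (p : X → ℝ) (ρ : X → H →L[ℂ] H) (R : CovariantEstimation.RegionEstimator X Y H),
        CovariantEstimation.IsProbabilityDensity μ p →
        CovariantEstimation.IsCovariantFamily π ρ →
        ENNReal.ofReal
            (CovariantEstimation.minTypeIIError μ (R.successProb μ p ρ) p
                (CovariantEstimation.uniformDensity μ) *
              (1 / CovariantEstimation.branchingDenominator π (MulAction.stabilizer G x₀))) ≤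
          R.maxVolume μ / μ Set.univ) ∧
    (∀ (μ : Measure G) [μ.IsHaarMeasure]
        (p : G → ℝ) (ρ : G → H →L[ℂ] H) (R : CovariantEstimation.RegionEstimator G Y H),
        CovariantEstimation.IsProbabilityDensity μ p →
        CovariantEstimation.IsCovariantFamily π ρ →
        ENNReal.ofReal
            (CovariantEstimation.minTypeIIError μ (R.successProb μ p ρ) p
                (CovariantEstimation.uniformDensity μ) *
              (1 / CovariantEstimation.groupDenominator π)) ≤
          R.maxVolume μ / μ Set.univ) := by
  have hG : IsTopologicalGroup G := topologicalGroup_of_lieGroup 𝓘(ℝ, E) ∞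
  refine ⟨?_, ?_⟩
  · intro μ _ _ x₀ p ρ R hp hρ
    exact CovariantEstimation.ofReal_minTypeIIError_mul_le hπ μ x₀
      (hsmooth.continuous.comp (continuous_id.prodMk continuous_const)) p R hp hρ
      CovariantEstimation.sum_minMultiplicity_le_branchingDenominator
  · intro μ _ p ρ R hp hρ
    -- With base point 1 the stabilizer is trivial, but it need not be identified: the group
    -- denominator dominates the branching numbers of every subgroup.
    exact CovariantEstimation.ofReal_minTypeIIError_mul_le hπ μ 1
      (continuous_mul_const 1) p R hp hρ
      CovariantEstimation.sum_minMultiplicity_le_groupDenominator
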